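/- **Theorem (recurrence relations).** Let $\lambda>0$ and $t_1,t_2\in(-\pi/2,\pi/2)$ with $t_1\neq t_2$, and for $j=1,2$ let $$w_j(x)=\frac{1}{2\pi}e^{2t_jx}\left|\Gamma(\lambda+ix)\right|^2,\qquad x\in\mathbb R .$$ For all integers $k_1,k_2\ge 0$ there is a unique monic polynomial $P_{k_1,k_2}$ (with real coefficients) of degree $k=k_1+k_2$ such that $$\int_{-\infty}^{\infty}P_{k_1,k_2}(x)\,x^m\,w_j(x)\,dx=0,\qquad m=0,\dots,k_j-1,\quad j=1,2$$ (the multiple Meixner–Pollaczek polynomial). Set $P_{-1,k_2}\equiv 0$ and $P_{k_1,-1}\equiv 0$ for all $k_1,k_2$, and, with $k=k_1+k_2$, put $$a_{k_1,k_2}^{t_1,t_2}=\frac{k+k_1+2\lambda}{2}\tan t_1+\frac{k_2}{2}\tan t_2,\qquad b_{k_1,k_2}^{t_1,t_2}=\frac{k+2\lambda-1}{4}\left(\frac{k_1}{\cos^2 t_1}+\frac{k_2}{\cos^2 t_2}\right),$$ $$c_{k_1,k_2}^{t_1,t_2}=\frac{k_1(k+2\lambda-1)(k+2\lambda-2)(\tan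 t_1-\tan t_2)}{8\cos^2 t_1}.$$ Then, for all integers $k_1,k_2\ge 0$ such that $k_2\ge 1$ or $k_1=0$, $$P_{k_1+1,k_2}(x)=\left(x-a_{k_1,k_2}^{t_1,t_2}\right)P_{k_1,k_2}(x)-b_{k_1,k_2}^{t_1,t_2}P_{k_1,k_2-1}(x)-c_{k_1,k_2}^{t_1,t_2}P_{k_1-1,k_2-1}(x),$$ and, for all integers $k_1,k_2\ge 0$ such that $k_1\ge 1$ or $k_2=0$, $$P_{k_1,k_2+1}(x)=\left(x-a_{k_2,k_1}^{t_2,t_1}\right)P_{k_1,k_2}(x)-b_{k_2,k_1}^{t_2,t_1}P_{k_1-1,k_2}(x)-c_{k_2,k_1}^{t_2,t_1}P_{k_1-1,k_2-1}(x).$$ In the remaining boundary cases, for all integers $k_1,k_2\ge 0$, $$P_{k_1+1,0}(x)=\left(x-a_{k_1,0}^{t_1,t_2}\right)P_{k_1,0}(x)-b_{k_1,0}^{t_1,t_2}P_{k_1-1,0}(x),$$ $$P_{0,k_2+1}(x)=\left(x-a_{k_2,0}^{t_2,t_1}\right)P_{0,k_2}(x)-b_{k_2,0}^{t_2,t_1}P_{0,k_2-1}(x).$$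 -/

import Mathlib

open Polynomial MeasureTheory

/-- The Meixner-Pollaczek weight `w(x) = (2π)⁻¹ exp (2 t x) |Γ(lam + i x)|²` on the real line. -/
noncomputable def mpWeight (lam t x : ℝ) : ℝ :=
  1 / (2 * Real.pi) * Real.exp (2 * t * x) *
    ‖Complex.Gamma ((lam : ℂ) + Complex.I * (x : ℂ))‖ ^ 2

/-- `P` is monic of degree `k₁ + k₂` and orthogonal to `x ^ m` for `m < k₁` with respect to the
weight with parameter `t₁`, and for `m < k₂` with respect to the weight with parameter `t₂`. For
`lam > 0` and `|t_j| < π / 2` the weights decay exponentially, so these integrals converge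
absolutely for every polynomial `P`. -/
structure IsMultipleMP (lam t₁ t₂ : ℝ) (k₁ k₂ : ℕ) (P : ℝ[X]) : Prop where
  monic : P.Monic
  natDegree_eq : P.natDegree = k₁ + k₂
  orthogonal_fst : ∀ m : ℕ, m < k₁ → ∫ x : ℝ, P.eval x * x ^ m * mpWeight lam t₁ x = 0
  orthogonal_snd : ∀ m : ℕ, m < k₂ → ∫ x : ℝ, P.eval x * x ^ m * mpWeight lam t₂ x = 0

open Classical in
/-- The multiple Meixner-Pollaczek polynomial with indices `k₁`, `k₂`, set to be `0` as soon as one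
of the indices is negative. -/
noncomputable def multipleMP (lam t₁ t₂ : ℝ) (k₁ k₂ : ℤ) : ℝ[X] :=
  if h : 0 ≤ k₁ ∧ 0 ≤ k₂ ∧ ∃ P : ℝ[X], IsMultipleMP lam t₁ t₂ k₁.toNat k₂.toNat P then
    h.2.2.choose
  else 0

/-- For nonnegative indices, `multipleMP` has the defining properties, provided that some polynomial
has them. -/
theorem multipleMP_spec {lam t₁ t₂ : ℝ} {k₁ k₂ : ℕ}
    (h : ∃ P : ℝ[X], IsMultipleMP lam t₁ t₂ k₁ k₂ P) :
    IsMultipleMP lam t₁ t₂ k₁ k₂ (multipleMP lam t₁ t₂ k₁ k₂) := by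
  have h' : 0 ≤ (k₁ : ℤ) ∧ 0 ≤ (k₂ : ℤ) ∧
      ∃ P : ℝ[X], IsMultipleMP lam t₁ t₂ (k₁ : ℤ).toNat (k₂ : ℤ).toNat P :=
    ⟨Int.natCast_nonneg k₁, Int.natCast_nonneg k₂, h⟩
  unfold multipleMP
  rw [dif_pos h']
  exact h'.2.2.choose_spec

/-- The recurrence coefficient `a`. -/
noncomputable def mpA (lam t₁ t₂ : ℝ) (k₁ k₂ : ℕ) : ℝ :=
  (((k₁ : ℝ) + k₂) + k₁ + 2 * lam) / 2 * Real.tan t₁ + (k₂ : ℝ) / 2 * Real.tan t₂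

/-- The recurrence coefficient `b`. -/
noncomputable def mpB (lam t₁ t₂ : ℝ) (k₁ k₂ : ℕ) : ℝ :=
  (((k₁ : ℝ) + k₂) + 2 * lam - 1) / 4 * (k₁ / Real.cos t₁ ^ 2 + k₂ / Real.cos t₂ ^ 2)

/-- The recurrence coefficient `c`. -/
noncomputable def mpC (lam t₁ t₂ : ℝ) (k₁ k₂ : ℕ) : ℝ :=
  k₁ * (((k₁ : ℝ) + k₂) + 2 * lam - 1) * (((k₁ : ℝ) + k₂) + 2 * lam - 2) *
    (Real.tan t₁ - Real.tan t₂) / (8 * Real.cos t₁ ^ 2)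

/-!
Write `L lam s` for integration against the weight with parameters `lam` and `s`, which on the real
line is the restriction of the analytic function
`K lam s z = (2π)⁻¹ exp (2 s z) Γ(lam + i z) Γ(lam - i z)`. The functional equation of `Γ` gives
`K (lam + 1/2) s (z ± i/2) = (lam ∓ i z) exp (± i s) K lam s z`, so moving the line of integration
by `± i/2` relates `L (lam + 1/2) s` to `L lam s`. It follows that the raising operator `R lam t`
(`mpRaise`) satisfies `L lam s (R lam t q * r) = cos s * L (lam + 1/2) s (q * D r)`, where the
adjoint `D` is a difference operator that lowers degrees if `s = t` and preserves them otherwise.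
Hence applying raising operators to `1`, each parameter `t_j` being used `k_j` times, gives the
multiple orthogonal polynomial, and the same identity computes its first nonvanishing moments.

These moments imply uniqueness. They also identify the recurrence: the difference of its two sides
has degree less than `k₁ + k₂` and satisfies all `k₁ + k₂` orthogonality conditions, once `a`
matches the two highest coefficients and `b`, `c` match the leading moments.
-/

section HorizontalShift

open Filter Topology

theorem integrable_horizontal_line {f : ℂ → ℂ} {v : ℝ} {g : ℝ → ℝ} {S : Set ℝ}
    (hf : ContinuousOn f {z | z.im ∈ S}) (hfg : ∀ x : ℝ, ‖f (x + v * Complex.I)‖ ≤ g x)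
    (hg : Integrable g) (hv : v ∈ S) : Integrable fun x : ℝ => f (x + v * Complex.I) :=
  hg.mono' (hf.comp_continuous (by fun_prop) (by simpa using hv)).aestronglyMeasurable
    (ae_of_all _ hfg)

theorem integral_horizontal_line_shift {f : ℂ → ℂ} {c : ℝ} {g : ℝ → ℝ}
    (hf : DifferentiableOn ℂ f {z | z.im ∈ Set.uIcc 0 c})
    (hfg : ∀ x : ℝ, ∀ v ∈ Set.uIcc 0 c, ‖f (x + v * Complex.I)‖ ≤ g x)
    (hg : Integrable g) (hg₀ : Tendsto g (cocompact ℝ) (𝓝 0)) :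
    ∫ x : ℝ, f (x + c * Complex.I) = ∫ x : ℝ, f x := by
  have rectangle (T : ℝ) : (∫ x in (-T)..T, f x) - (∫ x in (-T)..T, f (x + c * Complex.I)) =
      Complex.I * (∫ y in (0 : ℝ)..c, f ((-T : ℝ) + y * Complex.I)) -
        Complex.I * (∫ y in (0 : ℝ)..c, f (T + y * Complex.I)) := by
    have h := Complex.integral_boundary_rect_eq_zero_of_differentiableOn f (-T : ℝ)
      (T + c * Complex.I) (hf.mono fun z hz => by simpa using hz.2)
    simp only [Complex.ofReal_im, Complex.ofReal_zero, zero_mul, add_zero, Complex.ofReal_re,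
      Complex.add_re, Complex.mul_re, Complex.I_re, mul_zero, Complex.I_im, sub_zero,
      Complex.add_im, Complex.mul_im, mul_one, zero_add, smul_eq_mul] at h
    linear_combination h
  have side : Tendsto (fun T : ℝ => Complex.I * ∫ y in (0 : ℝ)..c, f (T + y * Complex.I))
      (cocompact ℝ) (𝓝 0) := by
    refine squeeze_zero_norm (a := fun T => g T * |c - 0|) (fun T => ?_)
      (by simpa using hg₀.mul_const |c - 0|)
    rw [norm_mul, Complex.norm_I, one_mul]
    exact intervalIntegral.norm_integral_le_of_norm_le_const
      fun y hy => hfg T y (Set.uIoc_subset_uIcc hy)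
  have line {v : ℝ} (hv : v ∈ Set.uIcc 0 c) :
      Tendsto (fun T : ℝ => ∫ x in (-T)..T, f (x + v * Complex.I)) atTop
        (𝓝 (∫ x : ℝ, f (x + v * Complex.I))) :=
    intervalIntegral_tendsto_integral
      (integrable_horizontal_line hf.continuousOn (fun x => hfg x v hv) hg hv)
      tendsto_neg_atTop_atBot tendsto_id
  have line₀ := line (Set.left_mem_uIcc (a := 0) (b := c))
  simp only [Complex.ofReal_zero, zero_mul, add_zero] at line₀
  have lines := line₀.sub (line Set.right_mem_uIcc)
  have sides := (side.comp (tendsto_neg_atTop_atBot.mono_right atBot_le_cocompact)).sub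
    (side.mono_left atTop_le_cocompact)
  have := tendsto_nhds_unique lines (sides.congr fun T => (rectangle T).symm)
  rw [sub_zero, sub_eq_zero] at this
  exact this.symm

end HorizontalShift

section GammaDecay

open scoped Real

theorem integral_exp_smul_comp_exp {E : Type*} [NormedAddCommGroup E] [NormedSpace ℝ E]
    (f : ℝ → E) : ∫ u : ℝ, Real.exp u • f (Real.exp u) = ∫ t in Set.Ioi 0, f t := by
  have h := integral_image_eq_integral_abs_deriv_smul MeasurableSet.univ
    (fun x _ => (Real.hasDerivAt_exp x).hasDerivWithinAt) Real.exp_injective.injOn f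
  simpa [Real.abs_exp] using h.symm

theorem integrable_exp_smul_comp_exp {E : Type*} [NormedAddCommGroup E] [NormedSpace ℝ E]
    {f : ℝ → E} :
    Integrable (fun u : ℝ => Real.exp u • f (Real.exp u)) ↔ IntegrableOn f (Set.Ioi 0) := by
  have h := integrableOn_image_iff_integrableOn_abs_deriv_smul MeasurableSet.univ
    (fun x _ => (Real.hasDerivAt_exp x).hasDerivWithinAt) Real.exp_injective.injOn f
  simpa [Real.abs_exp] using h.symm

theorem exp_smul_rpow_exp (σ c u : ℝ) :
    Real.exp u • (Real.exp u ^ (σ - 1) * Real.exp (-(c * Real.exp u))) =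
      Real.exp (σ * u) * Real.exp (-(c * Real.exp u)) := by
  rw [smul_eq_mul, ← mul_assoc, ← Real.exp_mul, ← Real.exp_add]
  ring_nf

theorem integral_exp_mul_exp_neg_mul_exp {σ c : ℝ} (hσ : 0 < σ) (hc : 0 < c) :
    ∫ u : ℝ, Real.exp (σ * u) * Real.exp (-(c * Real.exp u)) = (1 / c) ^ σ * Real.Gamma σ := by
  rw [← Real.integral_rpow_mul_exp_neg_mul_Ioi hσ hc, ← integral_exp_smul_comp_exp]
  simp only [exp_smul_rpow_exp]

theorem integrable_exp_mul_exp_neg_mul_exp {σ c : ℝ} (hσ : 0 < σ) (hc : 0 < c) :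
    Integrable fun u : ℝ => Real.exp (σ * u) * Real.exp (-(c * Real.exp u)) := by
  have h := integrableOn_rpow_mul_exp_neg_mul_rpow (s := σ - 1) (by linarith) one_pos hc
  simp only [Real.rpow_one, neg_mul] at h
  simpa only [exp_smul_rpow_exp] using integrable_exp_smul_comp_exp.2 h

theorem Gamma_eq_integral_exp_mul_exp_neg_exp {s : ℂ} (hs : 0 < s.re) :
    Complex.Gamma s = ∫ u : ℝ, Complex.exp (s * u) * Complex.exp (-Complex.exp u) := by
  rw [Complex.Gamma_eq_integral hs, Complex.GammaIntegral, ← integral_exp_smul_comp_exp]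
  congr with u
  rw [Complex.real_smul, Complex.ofReal_exp, Complex.cpow_def_of_ne_zero (Complex.exp_ne_zero _),
    ← Complex.ofReal_exp, ← Complex.ofReal_log (Real.exp_pos u).le, Real.log_exp]
  push_cast
  rw [← Complex.exp_add, ← Complex.exp_add, ← Complex.exp_add]
  ring_nf

theorem tendsto_exp_mul_exp_neg_mul_exp_cocompact {σ c : ℝ} (hσ : 0 < σ) (hc : 0 < c) :
    Filter.Tendsto (fun u : ℝ => Real.exp (σ * u) * Real.exp (-(c * Real.exp u)))
      (Filter.cocompact ℝ) (nhds 0) := by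
  rw [cocompact_eq_atBot_atTop, Filter.tendsto_sup]
  constructor
  · refine squeeze_zero (g := fun u => Real.exp (σ * u)) (fun u => by positivity) (fun u => ?_)
      (Real.tendsto_exp_atBot.comp (Filter.tendsto_id.const_mul_atBot hσ))
    exact mul_le_of_le_one_right (Real.exp_pos _).le (Real.exp_le_one_iff.2 (by
      rw [neg_nonpos]; positivity))
  · refine ((tendsto_rpow_mul_exp_neg_mul_atTop_nhds_zero σ c hc).comp
      Real.tendsto_exp_atTop).congr fun u => ?_
    rw [Function.comp_apply, ← Real.exp_mul, mul_comm u, neg_mul]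

theorem norm_exp_mul_exp_neg_exp (s : ℂ) (u v : ℝ) :
    ‖Complex.exp (s * (u + v * Complex.I)) * Complex.exp (-Complex.exp (u + v * Complex.I))‖ =
      Real.exp (-(v * s.im)) *
        (Real.exp (s.re * u) * Real.exp (-(Real.cos v * Real.exp u))) := by
  rw [norm_mul, Complex.norm_exp, Complex.norm_exp, Complex.neg_re, Complex.exp_re,
    ← Real.exp_add, ← Real.exp_add, ← Real.exp_add]
  simp only [Complex.mul_re, Complex.add_re, Complex.ofReal_re, Complex.I_re, mul_zero,
    Complex.ofReal_im, Complex.I_im, mul_one, sub_self, add_zero, Complex.add_im, Complex.mul_im,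
    zero_add]
  ring_nf

theorem norm_Gamma_le_mul_exp {s : ℂ} (hs : 0 < s.re) {φ : ℝ}
    (hφ : φ ∈ Set.Ioo (-(π / 2)) (π / 2)) :
    ‖Complex.Gamma s‖ ≤ (1 / Real.cos φ) ^ s.re * Real.Gamma s.re * Real.exp (-(φ * s.im)) := by
  have hcos : 0 < Real.cos φ := Real.cos_pos_of_mem_Ioo hφ
  set F : ℂ → ℂ := fun z => Complex.exp (s * z) * Complex.exp (-Complex.exp z)
  have hF (u v : ℝ) (hv : v ∈ Set.uIcc 0 φ) : ‖F (u + v * Complex.I)‖ ≤ Real.exp (|φ| * |s.im|) *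
      (Real.exp (s.re * u) * Real.exp (-(Real.cos φ * Real.exp u))) := by
    have hvφ : |v| ≤ |φ| := by simpa using Set.abs_sub_left_of_mem_uIcc hv
    have hcosv : Real.cos φ ≤ Real.cos v := by
      rw [← Real.cos_abs φ, ← Real.cos_abs v]
      exact Real.cos_le_cos_of_nonneg_of_le_pi (abs_nonneg v)
        (by linarith [abs_lt.2 hφ, Real.pi_pos]) hvφ
    have : -(v * s.im) ≤ |φ| * |s.im| :=
      (neg_le_abs _).trans (by rw [abs_mul]; gcongr)
    rw [norm_exp_mul_exp_neg_exp]
    gcongr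
  have shift := integral_horizontal_line_shift (f := F) (c := φ) (by fun_prop) hF
    ((integrable_exp_mul_exp_neg_mul_exp hs hcos).const_mul _)
    (by simpa only [mul_zero] using
      (tendsto_exp_mul_exp_neg_mul_exp_cocompact hs hcos).const_mul (Real.exp (|φ| * |s.im|)))
  calc ‖Complex.Gamma s‖ = ‖∫ u : ℝ, F (u + φ * Complex.I)‖ := by
        rw [shift, Gamma_eq_integral_exp_mul_exp_neg_exp hs]
    _ ≤ ∫ u : ℝ, ‖F (u + φ * Complex.I)‖ := norm_integral_le_integral_norm _
    _ = _ := by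
        simp only [F, norm_exp_mul_exp_neg_exp, integral_const_mul,
          integral_exp_mul_exp_neg_mul_exp hs hcos]
        ring

end GammaDecay

section MomentFunctional

/-- The functional sending a complex polynomial `p` to its integral against the real weight `w`.
It is defined through the moments of `w`, so it is linear whether or not they converge. -/
noncomputable def momentFunctional (w : ℝ → ℝ) : ℂ[X] →ₗ[ℂ] ℂ :=
  Polynomial.lsum fun n => ((∫ x, x ^ n * w x : ℝ) : ℂ) • LinearMap.id

theorem momentFunctional_apply (w : ℝ → ℝ) (p : ℂ[X]) :
    momentFunctional w p = p.sum fun n a => a * ((∫ x, x ^ n * w x : ℝ) : ℂ) := by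
  simp [momentFunctional, Polynomial.lsum_apply, mul_comm]

theorem momentFunctional_eq_integral {w : ℝ → ℝ} (hw : ∀ n : ℕ, Integrable fun x => x ^ n * w x)
    (p : ℂ[X]) : momentFunctional w p = ∫ x : ℝ, p.eval (x : ℂ) * (w x : ℂ) := by
  simp only [momentFunctional_apply, eval_eq_sum, Polynomial.sum, Finset.sum_mul, mul_assoc,
    ← integral_complex_ofReal, ← integral_const_mul]
  rw [integral_finsetSum _ fun n _ => ?_]
  · push_cast
    rfl
  · exact_mod_cast (hw n).ofReal.const_mul (p.coeff n)

theorem momentFunctional_map_conj (w : ℝ → ℝ) (p : ℂ[X]) :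
    momentFunctional w (p.map (starRingEnd ℂ)) = starRingEnd ℂ (momentFunctional w p) := by
  rw [momentFunctional_apply, momentFunctional_apply,
    Polynomial.sum_over_range' _ (by simp) _ (Nat.lt_succ_of_le natDegree_map_le),
    Polynomial.sum_over_range _ (by simp)]
  simp only [coeff_map, map_sum, map_mul, Complex.conj_ofReal]

theorem momentFunctional_map_mul_X_pow {w : ℝ → ℝ}
    (hw : ∀ n : ℕ, Integrable fun x => x ^ n * w x) (P : ℝ[X]) (m : ℕ) :
    momentFunctional w (P.map Complex.ofRealHom * X ^ m) =
      ((∫ x, P.eval x * x ^ m * w x : ℝ) : ℂ) := by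
  rw [momentFunctional_eq_integral hw, ← integral_complex_ofReal]
  congr with x
  rw [eval_mul, eval_pow, eval_X, ← Complex.ofRealHom_eq_coe, eval_map_apply]
  push_cast
  rfl

end MomentFunctional

section Kernel

open scoped Real

theorem exists_norm_eval_le_exp (p : ℂ[X]) {δ : ℝ} (hδ : 0 < δ) :
    ∃ K : ℝ, 0 ≤ K ∧ ∀ z : ℂ, ‖p.eval z‖ ≤ K * Real.exp (δ * ‖z‖) := by
  induction p using Polynomial.induction_on' with
  | add p q hp hq =>
    obtain ⟨K, hK, h⟩ := hp
    obtain ⟨K', hK', h'⟩ := hq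
    refine ⟨K + K', by positivity, fun z => ?_⟩
    rw [eval_add, add_mul]
    exact (norm_add_le _ _).trans (add_le_add (h z) (h' z))
  | monomial n a =>
    refine ⟨‖a‖ * (n.factorial / δ ^ n), by positivity, fun z => ?_⟩
    have hexp := Real.pow_div_factorial_le_exp (x := δ * ‖z‖) (by positivity) n
    rw [div_le_iff₀ (by positivity), mul_pow] at hexp
    rw [eval_monomial, norm_mul, norm_pow, mul_assoc]
    gcongr
    rw [div_mul_eq_mul_div, le_div_iff₀ (by positivity)]
    linarith

theorem integrable_exp_neg_mul_abs {ε : ℝ} (hε : 0 < ε) :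
    Integrable fun x : ℝ => Real.exp (-(ε * |x|)) := by
  rw [← integrableOn_univ, ← Set.Iic_union_Ioi (a := (0 : ℝ))]
  refine ((integrableOn_exp_mul_Iic hε 0).congr_fun (fun x hx => ?_) measurableSet_Iic).union
    ((exp_neg_integrableOn_Ioi 0 hε).congr_fun (fun x hx => ?_) measurableSet_Ioi)
  · simp only [abs_of_nonpos (Set.mem_Iic.1 hx), mul_neg, neg_neg]
  · simp only [abs_of_pos (Set.mem_Ioi.1 hx), neg_mul]

/-- The analytic continuation of `mpWeight` from the real line to the strip `|im z| < lam`. -/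
noncomputable def mpKernel (lam t : ℝ) (z : ℂ) : ℂ :=
  1 / (2 * π) * Complex.exp (2 * t * z) *
    (Complex.Gamma (lam + Complex.I * z) * Complex.Gamma (lam - Complex.I * z))

theorem mpKernel_ofReal (lam t x : ℝ) : mpKernel lam t x = (mpWeight lam t x : ℂ) := by
  have hconj : (lam - Complex.I * x : ℂ) = starRingEnd ℂ (lam + Complex.I * x) := by
    simp [sub_eq_add_neg]
  rw [mpKernel, mpWeight, hconj, Complex.Gamma_conj, Complex.mul_conj, Complex.normSq_eq_norm_sq]
  push_cast
  rfl

theorem differentiableAt_Gamma_of_re_pos {s : ℂ} (hs : 0 < s.re) :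
    DifferentiableAt ℂ Complex.Gamma s :=
  Complex.differentiableAt_Gamma s fun m hm => by
    have : s.re = -m := by simp [hm]
    linarith [Nat.cast_nonneg (α := ℝ) m]

theorem differentiableAt_mpKernel {lam : ℝ} (t : ℝ) {z : ℂ} (hz : |z.im| < lam) :
    DifferentiableAt ℂ (mpKernel lam t) z := by
  obtain ⟨hz₁, hz₂⟩ := abs_lt.1 hz
  have h₁ : 0 < (lam + Complex.I * z).re := by simpa using hz₂
  have h₂ : 0 < (lam - Complex.I * z).re := by simpa [neg_lt_iff_pos_add'] using hz₁
  exact .mul (by fun_prop)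
    (((differentiableAt_Gamma_of_re_pos h₁).comp z (by fun_prop)).mul
      ((differentiableAt_Gamma_of_re_pos h₂).comp z (by fun_prop)))

theorem mpKernel_add_half {lam : ℝ} (t : ℝ) {z : ℂ} (hz : lam - Complex.I * z ≠ 0) :
    mpKernel (lam + 1 / 2) t (z + Complex.I / 2) =
      Complex.exp (t * Complex.I) * ((lam - Complex.I * z) * mpKernel lam t z) := by
  have h₁ : ((lam + 1 / 2 : ℝ) : ℂ) + Complex.I * (z + Complex.I / 2) = lam + Complex.I * z := by
    push_cast
    linear_combination (1 / 2 : ℂ) * Complex.I_sq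
  have h₂ : ((lam + 1 / 2 : ℝ) : ℂ) - Complex.I * (z + Complex.I / 2) =
      lam - Complex.I * z + 1 := by
    push_cast
    linear_combination (-1 / 2 : ℂ) * Complex.I_sq
  rw [mpKernel, mpKernel, h₁, h₂, Complex.Gamma_add_one _ hz,
    show 2 * (t : ℂ) * (z + Complex.I / 2) = t * Complex.I + 2 * t * z by ring, Complex.exp_add]
  ring

theorem norm_mpKernel_le {lam t φ : ℝ} (hφ : φ ∈ Set.Ioo (-(π / 2)) (π / 2)) {z : ℂ}
    (hz : |z.im| < lam) :
    ‖mpKernel lam t z‖ ≤ 1 / (2 * π) * (1 / Real.cos φ) ^ (2 * lam) *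
      (Real.Gamma (lam - z.im) * Real.Gamma (lam + z.im)) *
        Real.exp (2 * (t * z.re) - 2 * (φ * z.re)) := by
  obtain ⟨hz₁, hz₂⟩ := abs_lt.1 hz
  have hcos : 0 < 1 / Real.cos φ := one_div_pos.2 (Real.cos_pos_of_mem_Ioo hφ)
  have h₁ := norm_Gamma_le_mul_exp (s := lam + Complex.I * z) (by simpa using hz₂) hφ
  have h₂ := norm_Gamma_le_mul_exp (s := lam - Complex.I * z)
    (by simpa [neg_lt_iff_pos_add'] using hz₁) (φ := -φ) ⟨by linarith [hφ.2], by linarith [hφ.1]⟩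
  simp only [Complex.add_re, Complex.sub_re, Complex.ofReal_re, Complex.mul_re, Complex.I_re,
    zero_mul, Complex.I_im, one_mul, zero_sub, sub_neg_eq_add, Complex.add_im, Complex.sub_im,
    Complex.ofReal_im, Complex.mul_im, zero_add, mul_neg, Real.cos_neg, neg_mul, neg_neg,
    ← sub_eq_add_neg] at h₁ h₂
  have hexp : ‖Complex.exp (2 * t * z)‖ = Real.exp (2 * (t * z.re)) := by
    rw [Complex.norm_exp, mul_assoc]
    simp
  have hpi : ‖(1 / (2 * π) : ℂ)‖ = 1 / (2 * π) := by
    simp [abs_of_pos Real.pi_pos]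
  rw [mpKernel, norm_mul, norm_mul, norm_mul, hpi, hexp]
  refine (mul_le_mul_of_nonneg_left (mul_le_mul h₁ h₂ (norm_nonneg _) (by positivity))
    (by positivity)).trans_eq ?_
  have hexp₂ : Real.exp (2 * (t * z.re) - 2 * (φ * z.re)) =
      Real.exp (2 * (t * z.re)) * (Real.exp (-(φ * z.re)) * Real.exp (-(φ * z.re))) := by
    rw [← Real.exp_add, ← Real.exp_add]
    ring_nf
  have hpow : (1 / Real.cos φ) ^ (2 * lam) =
      (1 / Real.cos φ) ^ (lam - z.im) * (1 / Real.cos φ) ^ (lam + z.im) := by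
    rw [← Real.rpow_add hcos]
    ring_nf
  rw [hexp₂, hpow]
  ring

theorem exists_norm_mpKernel_le {lam t d : ℝ} (hd : d < lam)
    (ht : t ∈ Set.Ioo (-(π / 2)) (π / 2)) :
    ∃ ε > 0, ∃ K : ℝ, 0 ≤ K ∧ ∀ z : ℂ, |z.im| ≤ d →
      ‖mpKernel lam t z‖ ≤ K * Real.exp (-(ε * |z.re|)) := by
  obtain ⟨θ, htθ, hθ⟩ := exists_between (abs_lt.2 ht)
  have hθ₀ : 0 < θ := (abs_nonneg t).trans_lt htθ
  have hΓc := Real.differentiableOn_Gamma_Ioi.continuousOn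
  have hcont : ContinuousOn (fun v => Real.Gamma (lam - v) * Real.Gamma (lam + v))
      (Set.Icc (-d) d) :=
    (hΓc.comp (by fun_prop) fun v hv => sub_pos.2 (hv.2.trans_lt hd)).mul
      (hΓc.comp (by fun_prop) fun v hv => neg_lt_iff_pos_add'.1 ((neg_lt_neg hd).trans_le hv.1))
  obtain ⟨M, hM⟩ := isCompact_Icc.exists_bound_of_continuousOn hcont
  have hcos : 0 < Real.cos θ := Real.cos_pos_of_mem_Ioo ⟨by linarith, hθ⟩
  refine ⟨2 * (θ - |t|), by linarith,
    1 / (2 * π) * (1 / Real.cos θ) ^ (2 * lam) * |M|, by positivity, fun z hz => ?_⟩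
  have hΓ : Real.Gamma (lam - z.im) * Real.Gamma (lam + z.im) ≤ |M| :=
    (Real.le_norm_self _).trans ((hM z.im (abs_le.1 hz)).trans (le_abs_self M))
  have hbound {φ : ℝ} (hφ : |φ| = θ) (hφz : φ * z.re = θ * |z.re|) : ‖mpKernel lam t z‖ ≤
      1 / (2 * π) * (1 / Real.cos θ) ^ (2 * lam) * |M| *
        Real.exp (-(2 * (θ - |t|) * |z.re|)) := by
    have htz : t * z.re ≤ |t| * |z.re| := (le_abs_self _).trans_eq (abs_mul _ _)
    refine (norm_mpKernel_le (abs_lt.1 (hφ.trans_lt hθ)) (hz.trans_lt hd)).trans ?_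
    rw [← Real.cos_abs φ, hφ]
    gcongr
    linarith
  rcases le_total 0 z.re with hx | hx
  · exact hbound (abs_of_pos hθ₀) (by rw [abs_of_nonneg hx])
  · exact hbound (φ := -θ) (by rw [abs_neg, abs_of_pos hθ₀]) (by rw [abs_of_nonpos hx]; ring)

theorem exists_norm_eval_mul_mpKernel_le {lam t d : ℝ} (hd : d < lam)
    (ht : t ∈ Set.Ioo (-(π / 2)) (π / 2)) (p : ℂ[X]) :
    ∃ ε > 0, ∃ K : ℝ, ∀ x v : ℝ, |v| ≤ d →
      ‖p.eval (x + v * Complex.I) * mpKernel lam t (x + v * Complex.I)‖ ≤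
        K * Real.exp (-(ε * |x|)) := by
  obtain ⟨ε, hε, K, _, hK⟩ := exists_norm_mpKernel_le hd ht
  obtain ⟨M, hM₀, hM⟩ := exists_norm_eval_le_exp p (half_pos hε)
  refine ⟨ε / 2, half_pos hε, M * Real.exp (ε / 2 * d) * K, fun x v hv => ?_⟩
  have hz : ‖(x + v * Complex.I : ℂ)‖ ≤ |x| + d := by
    refine (norm_add_le _ _).trans ?_
    simpa using hv
  calc ‖p.eval (x + v * Complex.I) * mpKernel lam t (x + v * Complex.I)‖
      ≤ M * Real.exp (ε / 2 * (|x| + d)) * (K * Real.exp (-(ε * |x|))) := by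
        rw [norm_mul]
        gcongr
        · exact (hM _).trans (by gcongr)
        · simpa using hK (x + v * Complex.I) (by simpa using hv)
    _ = M * Real.exp (ε / 2 * d) * K *
        (Real.exp (ε / 2 * |x|) * Real.exp (-(ε * |x|))) := by
        rw [mul_add, Real.exp_add]
        ring
    _ = M * Real.exp (ε / 2 * d) * K * Real.exp (-(ε / 2 * |x|)) := by
        rw [← Real.exp_add]
        ring_nf

end Kernel

section Functional

open scoped Real

variable {lam s : ℝ}

/-- Integration of complex polynomials against the weight `mpWeight lam s`. -/
noncomputable def mpFunctional (lam s : ℝ) : ℂ[X] →ₗ[ℂ] ℂ :=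
  momentFunctional (mpWeight lam s)

theorem integral_eval_mul_mpKernel_shift {c : ℝ} (hc : |c| < lam)
    (hs : s ∈ Set.Ioo (-(π / 2)) (π / 2)) (p : ℂ[X]) :
    ∫ x : ℝ, p.eval (x + c * Complex.I) * mpKernel lam s (x + c * Complex.I) =
      ∫ x : ℝ, p.eval (x : ℂ) * mpKernel lam s x := by
  obtain ⟨ε, hε, K, hK⟩ := exists_norm_eval_mul_mpKernel_le hc hs p
  have habs {v : ℝ} (hv : v ∈ Set.uIcc 0 c) : |v| ≤ |c| := by
    simpa using Set.abs_sub_left_of_mem_uIcc hv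
  refine integral_horizontal_line_shift (f := fun z => p.eval z * mpKernel lam s z)
    (fun z hz => ?_) (fun x v hv => hK x v (habs hv))
    ((integrable_exp_neg_mul_abs hε).const_mul K) ?_
  · exact (p.differentiableAt.mul
      (differentiableAt_mpKernel s ((habs hz).trans_lt hc))).differentiableWithinAt
  · have htendsto := Real.tendsto_exp_neg_atTop_nhds_zero.comp
      ((tendsto_norm_cocompact_atTop (E := ℝ)).const_mul_atTop hε)
    simpa only [mul_zero, Function.comp_def, Real.norm_eq_abs] using htendsto.const_mul K

theorem integrable_pow_mul_mpWeight (hlam : 0 < lam)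
    (hs : s ∈ Set.Ioo (-(π / 2)) (π / 2)) (n : ℕ) :
    Integrable fun x : ℝ => x ^ n * mpWeight lam s x := by
  obtain ⟨ε, hε, K, hK⟩ := exists_norm_eval_mul_mpKernel_le hlam hs (X ^ n)
  have h := integrable_horizontal_line (v := 0) (S := {0})
    (f := fun z => (X ^ n : ℂ[X]).eval z * mpKernel lam s z)
    (fun z (hz : z.im = 0) => ((X ^ n : ℂ[X]).continuous.continuousAt.mul
      (differentiableAt_mpKernel s (by simpa [hz])).continuousAt).continuousWithinAt)
    (fun x => hK x 0 abs_zero.le) ((integrable_exp_neg_mul_abs hε).const_mul K) rfl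
  simp only [Complex.ofReal_zero, zero_mul, add_zero, eval_pow, eval_X, mpKernel_ofReal] at h
  exact_mod_cast h.re

theorem mpFunctional_eq_integral (hlam : 0 < lam)
    (hs : s ∈ Set.Ioo (-(π / 2)) (π / 2)) (p : ℂ[X]) :
    mpFunctional lam s p = ∫ x : ℝ, p.eval (x : ℂ) * mpKernel lam s x := by
  simp only [mpFunctional, momentFunctional_eq_integral (integrable_pow_mul_mpWeight hlam hs),
    mpKernel_ofReal]

theorem cos_mul_one_sub_I_mul_tan (hs : Real.cos s ≠ 0) :
    (Real.cos s : ℂ) * (1 - Complex.I * Real.tan s) = Complex.exp (-(s * Complex.I)) := by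
  have htan : (Real.cos s : ℂ) * Real.tan s = Real.sin s := by
    exact_mod_cast (mul_comm _ _).trans (Real.tan_mul_cos hs)
  rw [← neg_mul, Complex.exp_mul_I, Complex.cos_neg, Complex.sin_neg, ← Complex.ofReal_cos,
    ← Complex.ofReal_sin]
  linear_combination -Complex.I * htan

theorem mpFunctional_add_half_shift_up (hlam : 0 < lam)
    (hs : s ∈ Set.Ioo (-(π / 2)) (π / 2)) (q : ℂ[X]) :
    Real.cos s * (1 - Complex.I * Real.tan s) * mpFunctional (lam + 1 / 2) s q =
      mpFunctional lam s ((C (lam : ℂ) - C Complex.I * X) * taylor (Complex.I / 2) q) := by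
  have hshift := integral_eval_mul_mpKernel_shift (lam := lam + 1 / 2) (c := 1 / 2)
    (by rw [abs_of_pos one_half_pos]; linarith) hs q
  rw [mpFunctional_eq_integral (by linarith) hs, mpFunctional_eq_integral hlam hs, ← hshift,
    cos_mul_one_sub_I_mul_tan (Real.cos_pos_of_mem_Ioo hs).ne', ← integral_const_mul]
  congr with x
  have hx : (lam - Complex.I * x : ℂ) ≠ 0 := fun h =>
    hlam.ne' (by simpa using congrArg Complex.re h)
  have hI : (x + (1 / 2 : ℝ) * Complex.I : ℂ) = x + Complex.I / 2 := by
    push_cast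
    ring
  have hexp : Complex.exp (-(s * Complex.I)) * Complex.exp (s * Complex.I) = 1 := by
    rw [← Complex.exp_add, neg_add_cancel, Complex.exp_zero]
  simp only [hI, mpKernel_add_half s hx, eval_mul, eval_sub, eval_C, eval_X, taylor_eval]
  linear_combination (q.eval (x + Complex.I / 2) * (lam - Complex.I * x) * mpKernel lam s x) * hexp

theorem mpFunctional_add_half_shift_down (hlam : 0 < lam)
    (hs : s ∈ Set.Ioo (-(π / 2)) (π / 2)) (q : ℂ[X]) :
    Real.cos s * (1 + Complex.I * Real.tan s) * mpFunctional (lam + 1 / 2) s q =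
      mpFunctional lam s ((C (lam : ℂ) + C Complex.I * X) * taylor (-(Complex.I / 2)) q) := by
  have h := congrArg (starRingEnd ℂ)
    (mpFunctional_add_half_shift_up hlam hs (q.map (starRingEnd ℂ)))
  have hconj : (starRingEnd ℂ).comp (starRingEnd ℂ) = RingHom.id ℂ := RingHom.ext Complex.conj_conj
  simp only [mpFunctional, map_mul, map_sub, map_one, ← momentFunctional_map_conj,
    Polynomial.map_mul, Polynomial.map_sub, map_C, map_X, map_taylor, Polynomial.map_map, hconj,
    Polynomial.map_id, Complex.conj_ofReal, Complex.conj_I, map_div₀, map_ofNat, neg_mul,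
    C_neg, sub_neg_eq_add, neg_div] at h
  exact h

theorem mpWeight_pos (hlam : 0 < lam) (t x : ℝ) : 0 < mpWeight lam t x := by
  have hΓ : Complex.Gamma (lam + Complex.I * x) ≠ 0 :=
    Complex.Gamma_ne_zero_of_re_pos (by simpa using hlam)
  unfold mpWeight
  positivity

theorem mpFunctional_one_ne_zero (hlam : 0 < lam)
    (hs : s ∈ Set.Ioo (-(π / 2)) (π / 2)) : mpFunctional lam s 1 ≠ 0 := by
  have hint := integrable_pow_mul_mpWeight hlam hs 0
  simp only [pow_zero, one_mul] at hint
  have hsupp : Function.support (mpWeight lam s) = Set.univ :=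
    Set.eq_univ_of_forall fun x => (mpWeight_pos hlam s x).ne'
  have hpos : 0 < ∫ x, mpWeight lam s x := by
    rw [integral_pos_iff_support_of_nonneg (fun x => (mpWeight_pos hlam s x).le) hint, hsupp]
    simp
  simpa [mpFunctional_eq_integral hlam hs, mpKernel_ofReal, integral_complex_ofReal] using hpos.ne'

theorem cos_mul_mpFunctional_add_half_one (hlam : 0 < lam)
    (hs : s ∈ Set.Ioo (-(π / 2)) (π / 2)) :
    Real.cos s * mpFunctional (lam + 1 / 2) s 1 = lam * mpFunctional lam s 1 := by
  have hup := mpFunctional_add_half_shift_up hlam hs 1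
  have hdown := mpFunctional_add_half_shift_down hlam hs 1
  rw [taylor_one] at hup hdown
  have hsum : (C (lam : ℂ) - C Complex.I * X) * C 1 + (C (lam : ℂ) + C Complex.I * X) * C 1 =
      (2 * lam : ℂ) • 1 := by
    rw [smul_eq_C_mul, C_mul, C_1, C_ofNat]
    ring
  have h := congrArg (mpFunctional lam s) hsum
  rw [map_add, ← hup, ← hdown, map_smul, smul_eq_mul] at h
  linear_combination h / 2

end Functional

section OrthogonalBelow

variable {R : Type*}

/-- The polynomials orthogonal, for the linear functional `L`, to all polynomials of degree less
than `n`; orthogonality is tested on the monomials. -/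
def orthogonalBelow [CommSemiring R] (L : R[X] →ₗ[R] R) (n : ℕ) : Submodule R R[X] where
  carrier := {Q | ∀ m < n, L (Q * X ^ m) = 0}
  add_mem' hP hQ m hm := by rw [add_mul, map_add, hP m hm, hQ m hm, add_zero]
  zero_mem' m _ := by rw [zero_mul, map_zero]
  smul_mem' a P hP m hm := by rw [smul_mul_assoc, map_smul, hP m hm, smul_zero]

theorem orthogonalBelow_antitone [CommSemiring R] (L : R[X] →ₗ[R] R) :
    Antitone (orthogonalBelow L) :=
  fun _ _ hmn _ hQ m hm => hQ m (hm.trans_le hmn)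

theorem apply_mul_of_mem_orthogonalBelow [CommSemiring R] {L : R[X] →ₗ[R] R} {n : ℕ} {Q r : R[X]}
    (hQ : Q ∈ orthogonalBelow L n) (hr : r.natDegree ≤ n) :
    L (Q * r) = r.coeff n * L (Q * X ^ n) := by
  have hterm (m : ℕ) : L (Q * (C (r.coeff m) * X ^ m)) = r.coeff m * L (Q * X ^ m) := by
    rw [← smul_eq_C_mul, mul_smul_comm, map_smul, smul_eq_mul]
  conv_lhs => rw [r.as_sum_range_C_mul_X_pow' (Nat.lt_succ_of_le hr), Finset.mul_sum, map_sum]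
  simp only [hterm, Finset.sum_range_succ]
  rw [Finset.sum_eq_zero fun m hm => by rw [hQ m (Finset.mem_range.1 hm), mul_zero], zero_add]

theorem X_mul_sub_mem_orthogonalBelow [CommRing R] {L : R[X] →ₗ[R] R} {n : ℕ} {P Q : R[X]}
    (hP : P ∈ orthogonalBelow L (n + 1)) (hQ : Q ∈ orthogonalBelow L n)
    (h : L (P * X ^ (n + 1)) = L (Q * X ^ n)) : X * P - Q ∈ orthogonalBelow L (n + 1) := by
  intro m hm
  have hX : X * P * X ^ m = P * X ^ (m + 1) := by ring
  rw [sub_mul, map_sub, hX, sub_eq_zero]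
  rcases (Nat.lt_succ_iff.1 hm).lt_or_eq with hlt | rfl
  · rw [hP _ (Nat.succ_lt_succ hlt), hQ _ hlt]
  · exact h

end OrthogonalBelow

theorem coeff_taylor_of_natDegree_le_succ {R : Type*} [CommSemiring R] {q : R[X]} {n : ℕ}
    (hq : q.natDegree ≤ n + 1) (r : R) :
    (taylor r q).coeff n = q.coeff n + (n + 1) * r * q.coeff (n + 1) := by
  rw [taylor_coeff, eval_eq_sum_range' (n := 2)
    (Nat.lt_succ_of_le ((natDegree_hasseDeriv_le q n).trans (by omega))), Finset.sum_range_succ,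
    Finset.sum_range_one, hasseDeriv_coeff, hasseDeriv_coeff]
  simp only [zero_add, Nat.choose_self, Nat.cast_one, one_mul, pow_zero, mul_one, pow_one,
    add_comm 1 n, Nat.choose_succ_self_right]
  push_cast
  ring

section Raise

open scoped Real

/-- The raising operator of the Meixner-Pollaczek weights. Multiplication by
`cos t * mpWeight lam t` turns it into the central difference
`f ↦ I / 2 * (f (x + I / 2) - f (x - I / 2))` applied to `f = q * mpWeight (lam + 1 / 2) t`. -/
noncomputable def mpRaise (lam t : ℝ) (q : ℂ[X]) : ℂ[X] :=
  C (Complex.I / 2) *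
    (C (1 + Complex.I * Real.tan t) * ((C (lam : ℂ) - C Complex.I * X) * taylor (Complex.I / 2) q) -
      C (1 - Complex.I * Real.tan t) *
        ((C (lam : ℂ) + C Complex.I * X) * taylor (-(Complex.I / 2)) q))

/-- The adjoint, up to the factor `cos s`, of `mpRaise lam t` between the functionals
`mpFunctional (lam + 1 / 2) s` and `mpFunctional lam s`. -/
noncomputable def mpLower (t s : ℝ) (r : ℂ[X]) : ℂ[X] :=
  C (Complex.I / 2) *
    (C ((1 + Complex.I * Real.tan t) * (1 - Complex.I * Real.tan s)) * taylor (-(Complex.I / 2)) r -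
      C ((1 - Complex.I * Real.tan t) * (1 + Complex.I * Real.tan s)) * taylor (Complex.I / 2) r)

theorem map_conj_mpRaise (lam t : ℝ) (q : ℂ[X]) :
    (mpRaise lam t q).map (starRingEnd ℂ) = mpRaise lam t (q.map (starRingEnd ℂ)) := by
  simp only [mpRaise, Polynomial.map_mul, Polynomial.map_sub, Polynomial.map_add, map_C, map_X,
    map_taylor, map_div₀, map_add, map_sub, map_mul, map_neg, map_one, map_ofNat,
    Complex.conj_ofReal, Complex.conj_I, neg_div, neg_neg, neg_mul, ← sub_eq_add_neg,
    sub_neg_eq_add, Polynomial.map_one]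
  ring

theorem coeff_mpRaise (lam t : ℝ) {q : ℂ[X]} {n : ℕ} (hq : q.natDegree ≤ n) :
    (mpRaise lam t q).coeff n =
      (X * q).coeff n - (2 * lam + n) / 2 * Real.tan t * q.coeff n := by
  have hX (r : ℂ) : (X * taylor r q).coeff n = (X * q).coeff n + n * r * q.coeff n := by
    cases n with
    | zero => simp
    | succ n => simpa using coeff_taylor_of_natDegree_le_succ hq r
  have hn (r : ℂ) : (taylor r q).coeff n = q.coeff n := by
    rw [coeff_taylor_of_natDegree_le_succ (hq.trans n.le_succ) r,
      coeff_eq_zero_of_natDegree_lt (Nat.lt_succ_of_le hq), mul_zero, add_zero]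
  simp only [mpRaise, coeff_C_mul, coeff_sub, coeff_add, sub_mul, add_mul, mul_assoc, hX, hn]
  linear_combination
    (Real.tan t * lam * q.coeff n - (X * q).coeff n -
      Real.tan t * n * q.coeff n / 2 * (Complex.I ^ 2 - 1)) * Complex.I_sq

theorem natDegree_mpRaise_le (lam t : ℝ) {q : ℂ[X]} {n : ℕ} (hq : q.natDegree ≤ n) :
    (mpRaise lam t q).natDegree ≤ n + 1 := by
  refine natDegree_le_iff_coeff_eq_zero.2 fun N hN => ?_
  obtain ⟨N, rfl⟩ := Nat.exists_eq_add_one_of_ne_zero (Nat.ne_zero_of_lt hN)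
  have hqN {m : ℕ} (hm : n < m) : q.coeff m = 0 :=
    coeff_eq_zero_of_natDegree_lt (hq.trans_lt hm)
  rw [coeff_mpRaise lam t (hq.trans (by omega)), coeff_X_mul, hqN (by omega), hqN (by omega),
    mul_zero, sub_zero]

theorem coeff_mpLower (t s : ℝ) {r : ℂ[X]} {n : ℕ} (hr : r.natDegree ≤ n + 1) :
    (mpLower t s r).coeff n = (Real.tan s - Real.tan t) * r.coeff n +
      (n + 1) / 2 * (1 + Real.tan s * Real.tan t) * r.coeff (n + 1) := by
  simp only [mpLower, coeff_C_mul, coeff_sub, coeff_taylor_of_natDegree_le_succ hr]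
  linear_combination
    ((Real.tan t - Real.tan s) * r.coeff n - (n + 1) / 2 * r.coeff (n + 1) +
      (n + 1) / 2 * Real.tan t * Real.tan s * r.coeff (n + 1) * (Complex.I ^ 2 - 1)) * Complex.I_sq

theorem natDegree_mpLower_le (t s : ℝ) {r : ℂ[X]} {n : ℕ} (hr : r.natDegree ≤ n) :
    (mpLower t s r).natDegree ≤ n := by
  refine natDegree_le_iff_coeff_eq_zero.2 fun N hN => ?_
  have hrN {m : ℕ} (hm : n < m) : r.coeff m = 0 :=
    coeff_eq_zero_of_natDegree_lt (hr.trans_lt hm)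
  rw [coeff_mpLower t s (hr.trans (by omega)), hrN hN, hrN (by omega), mul_zero, mul_zero, add_zero]

theorem natDegree_mpLower_self_le (s : ℝ) {r : ℂ[X]} {n : ℕ} (hr : r.natDegree ≤ n + 1) :
    (mpLower s s r).natDegree ≤ n := by
  refine natDegree_le_iff_coeff_eq_zero.2 fun N hN => ?_
  rw [coeff_mpLower s s (hr.trans (by omega)), sub_self, zero_mul,
    coeff_eq_zero_of_natDegree_lt (hr.trans_lt (by omega)), mul_zero, add_zero]

variable {lam s : ℝ}

theorem mpFunctional_mpRaise_mul (hlam : 0 < lam) (hs : s ∈ Set.Ioo (-(π / 2)) (π / 2)) (t : ℝ)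
    (q r : ℂ[X]) :
    mpFunctional lam s (mpRaise lam t q * r) =
      Real.cos s * mpFunctional (lam + 1 / 2) s (q * mpLower t s r) := by
  have hC (lam : ℝ) (a : ℂ) (p : ℂ[X]) :
      mpFunctional lam s (C a * p) = a * mpFunctional lam s p := by
    rw [C_mul', map_smul, smul_eq_mul]
  have htaylor (a : ℂ) (p : ℂ[X]) :
      taylor a (q * taylor (-a) p) = taylor a q * p := by
    rw [taylor_mul, taylor_taylor, add_neg_cancel, taylor_zero]
  have hup := mpFunctional_add_half_shift_up hlam hs (q * taylor (-(Complex.I / 2)) r)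
  have hdown := mpFunctional_add_half_shift_down hlam hs (q * taylor (Complex.I / 2) r)
  rw [htaylor] at hup
  have htaylor' := htaylor (-(Complex.I / 2)) r
  rw [neg_neg] at htaylor'
  rw [htaylor'] at hdown
  have hraise : mpRaise lam t q * r = C (Complex.I / 2) *
      (C (1 + Complex.I * Real.tan t) *
          ((C (lam : ℂ) - C Complex.I * X) * (taylor (Complex.I / 2) q * r)) -
        C (1 - Complex.I * Real.tan t) *
          ((C (lam : ℂ) + C Complex.I * X) * (taylor (-(Complex.I / 2)) q * r))) := by
    rw [mpRaise]
    ring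
  have hlower : q * mpLower t s r = C (Complex.I / 2) *
      (C ((1 + Complex.I * Real.tan t) * (1 - Complex.I * Real.tan s)) *
          (q * taylor (-(Complex.I / 2)) r) -
        C ((1 - Complex.I * Real.tan t) * (1 + Complex.I * Real.tan s)) *
          (q * taylor (Complex.I / 2) r)) := by
    rw [mpLower]
    ring
  rw [hraise, hlower, hC, hC, LinearMap.map_sub, LinearMap.map_sub, hC, hC, hC, hC, ← hup,
    ← hdown]
  ring

theorem mpFunctional_mpRaise_mul_of_mem (hlam : 0 < lam) (hs : s ∈ Set.Ioo (-(π / 2)) (π / 2))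
    (t : ℝ) {n : ℕ} {q r : ℂ[X]} (hq : q ∈ orthogonalBelow (mpFunctional (lam + 1 / 2) s) n)
    (hr : r.natDegree ≤ n) :
    mpFunctional lam s (mpRaise lam t q * r) = Real.cos s * (Real.tan s - Real.tan t) *
      r.coeff n * mpFunctional (lam + 1 / 2) s (q * X ^ n) := by
  rw [mpFunctional_mpRaise_mul hlam hs,
    apply_mul_of_mem_orthogonalBelow hq (natDegree_mpLower_le t s hr),
    coeff_mpLower t s (hr.trans n.le_succ),
    coeff_eq_zero_of_natDegree_lt (Nat.lt_succ_of_le hr)]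
  ring

theorem mpFunctional_mpRaise_self_mul_of_mem (hlam : 0 < lam)
    (hs : s ∈ Set.Ioo (-(π / 2)) (π / 2)) {n : ℕ} {q r : ℂ[X]}
    (hq : q ∈ orthogonalBelow (mpFunctional (lam + 1 / 2) s) n) (hr : r.natDegree ≤ n + 1) :
    mpFunctional lam s (mpRaise lam s q * r) = Real.cos s * ((n + 1) / (2 * Real.cos s ^ 2)) *
      r.coeff (n + 1) * mpFunctional (lam + 1 / 2) s (q * X ^ n) := by
  have htan : (1 + Real.tan s * Real.tan s : ℂ) = 1 / Real.cos s ^ 2 := by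
    have := Real.inv_one_add_tan_sq (Real.cos_pos_of_mem_Ioo hs).ne'
    exact_mod_cast (by rw [one_div, ← this, inv_inv, sq] : 1 + Real.tan s * Real.tan s = _)
  rw [mpFunctional_mpRaise_mul hlam hs,
    apply_mul_of_mem_orthogonalBelow hq (natDegree_mpLower_self_le s hr), coeff_mpLower s s hr,
    htan]
  ring

end Raise

section Rodrigues

open scoped Real

/-- The polynomial obtained from `1` by the raising operators with the parameters in `ts`, as in the
Rodrigues formula. If only `t₁` and `t₂` occur in `ts`, it is the multiple Meixner-Pollaczek
polynomial whose indices are their multiplicities. -/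
noncomputable def mpRodrigues : ℝ → List ℝ → ℂ[X]
  | _, [] => 1
  | lam, t :: ts => mpRaise lam t (mpRodrigues (lam + 1 / 2) ts)

theorem map_conj_mpRodrigues (lam : ℝ) (ts : List ℝ) :
    (mpRodrigues lam ts).map (starRingEnd ℂ) = mpRodrigues lam ts := by
  induction ts generalizing lam with
  | nil => exact Polynomial.map_one _
  | cons t ts ih => rw [mpRodrigues, map_conj_mpRaise, ih]

theorem natDegree_mpRodrigues_le (lam : ℝ) (ts : List ℝ) :
    (mpRodrigues lam ts).natDegree ≤ ts.length := by
  induction ts generalizing lam with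
  | nil => exact natDegree_one.le
  | cons t ts ih => exact natDegree_mpRaise_le lam t (ih _)

theorem coeff_mpRodrigues_eq_zero (lam : ℝ) {ts : List ℝ} {n : ℕ} (hn : ts.length < n) :
    (mpRodrigues lam ts).coeff n = 0 :=
  coeff_eq_zero_of_natDegree_lt ((natDegree_mpRodrigues_le lam ts).trans_lt hn)

theorem degree_mpRodrigues_lt (lam : ℝ) {ts : List ℝ} {n : ℕ} (hn : ts.length < n) :
    (mpRodrigues lam ts).degree < n :=
  (degree_lt_iff_coeff_zero _ _).2 fun _ hm => coeff_mpRodrigues_eq_zero lam (hn.trans_le hm)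

theorem coeff_length_mpRodrigues (lam : ℝ) (ts : List ℝ) :
    (mpRodrigues lam ts).coeff ts.length = 1 := by
  induction ts generalizing lam with
  | nil => exact coeff_one_zero
  | cons t ts ih =>
    rw [List.length_cons, mpRodrigues,
      coeff_mpRaise lam t ((natDegree_mpRodrigues_le _ ts).trans (Nat.le_succ _)), coeff_X_mul, ih,
      coeff_mpRodrigues_eq_zero _ (Nat.lt_succ_self _), mul_zero, sub_zero]

theorem coeff_length_X_mul_mpRodrigues (lam : ℝ) (ts : List ℝ) :
    (X * mpRodrigues lam ts).coeff ts.length =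
      ((-(2 * lam + ts.length - 1) / 2 * (ts.map Real.tan).sum : ℝ) : ℂ) := by
  induction ts generalizing lam with
  | nil => simp
  | cons t ts ih =>
    rw [List.length_cons, coeff_X_mul, mpRodrigues,
      coeff_mpRaise lam t (natDegree_mpRodrigues_le _ ts), ih, coeff_length_mpRodrigues,
      List.map_cons, List.sum_cons]
    push_cast
    ring

variable {lam s : ℝ}

theorem mpRodrigues_mem_orthogonalBelow (hlam : 0 < lam) (hs : s ∈ Set.Ioo (-(π / 2)) (π / 2))
    (ts : List ℝ) : mpRodrigues lam ts ∈ orthogonalBelow (mpFunctional lam s) (ts.count s) := by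
  induction ts generalizing lam with
  | nil => exact fun m hm => absurd hm m.not_lt_zero
  | cons t ts ih =>
    intro m hm
    have hq := ih (lam := lam + 1 / 2) (by linarith)
    rcases eq_or_ne t s with rfl | hts
    · rw [List.count_cons_self] at hm
      rw [mpRodrigues, mpFunctional_mpRaise_self_mul_of_mem hlam hs hq
        ((natDegree_X_pow m).trans_le hm.le), coeff_X_pow, if_neg hm.ne', mul_zero, zero_mul]
    · rw [List.count_cons_of_ne hts] at hm
      rw [mpRodrigues, mpFunctional_mpRaise_mul_of_mem hlam hs t hq
        ((natDegree_X_pow m).trans_le hm.le), coeff_X_pow, if_neg hm.ne', mul_zero, zero_mul]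

/-- The first moment of `mpRodrigues lam ts` against `mpWeight lam s` that orthogonality does not
force to vanish. -/
noncomputable def mpLeadingMoment (lam s : ℝ) (ts : List ℝ) : ℂ :=
  mpFunctional lam s (mpRodrigues lam ts * X ^ ts.count s)

/-- The factor, besides `lam + ts.length / 2`, by which `mpLeadingMoment lam s` changes from `ts` to
`t :: ts` if `s` occurs `n` times in `ts`. -/
noncomputable def leadingFactor (s t : ℝ) (n : ℕ) : ℝ :=
  if t = s then (n + 1) / (2 * Real.cos s ^ 2) else Real.tan s - Real.tan t

theorem leadingFactor_self (s : ℝ) (n : ℕ) :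
    leadingFactor s s n = (n + 1) / (2 * Real.cos s ^ 2) :=
  if_pos rfl

theorem leadingFactor_of_ne {s t : ℝ} (hts : t ≠ s) (n : ℕ) :
    leadingFactor s t n = Real.tan s - Real.tan t :=
  if_neg hts

theorem leadingFactor_ne_zero {t : ℝ} (hs : s ∈ Set.Ioo (-(π / 2)) (π / 2))
    (ht : t ∈ Set.Ioo (-(π / 2)) (π / 2)) (n : ℕ) : leadingFactor s t n ≠ 0 := by
  rcases eq_or_ne t s with rfl | hts
  · have := Real.cos_pos_of_mem_Ioo hs
    rw [leadingFactor_self]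
    positivity
  · rw [leadingFactor_of_ne hts]
    exact sub_ne_zero.2 fun h => hts (Real.injOn_tan ht hs h.symm)

theorem mpLeadingMoment_cons_add_half (hlam : 0 < lam) (hs : s ∈ Set.Ioo (-(π / 2)) (π / 2))
    (t : ℝ) (ts : List ℝ) :
    mpLeadingMoment lam s (t :: ts) =
      Real.cos s * leadingFactor s t (ts.count s) * mpLeadingMoment (lam + 1 / 2) s ts := by
  have hq := mpRodrigues_mem_orthogonalBelow (lam := lam + 1 / 2) (by linarith) hs ts
  rcases eq_or_ne t s with rfl | hts
  · rw [mpLeadingMoment, mpRodrigues, List.count_cons_self,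
      mpFunctional_mpRaise_self_mul_of_mem hlam hs hq (natDegree_X_pow _).le, coeff_X_pow_self,
      leadingFactor_self, mpLeadingMoment]
    push_cast
    ring
  · rw [mpLeadingMoment, mpRodrigues, List.count_cons_of_ne hts,
      mpFunctional_mpRaise_mul_of_mem hlam hs t hq (natDegree_X_pow _).le, coeff_X_pow_self,
      leadingFactor_of_ne hts, mpLeadingMoment]
    push_cast
    ring

theorem cos_mul_mpLeadingMoment_add_half (hlam : 0 < lam) (hs : s ∈ Set.Ioo (-(π / 2)) (π / 2))
    (ts : List ℝ) :
    Real.cos s * mpLeadingMoment (lam + 1 / 2) s ts =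
      (lam + ts.length / 2) * mpLeadingMoment lam s ts := by
  induction ts generalizing lam with
  | nil => simpa [mpLeadingMoment, mpRodrigues] using cos_mul_mpFunctional_add_half_one hlam hs
  | cons t ts ih =>
    rw [mpLeadingMoment_cons_add_half hlam hs, mpLeadingMoment_cons_add_half (by linarith) hs,
      mul_right_comm (Real.cos s : ℂ) _ (mpLeadingMoment _ s ts), ih (by linarith),
      List.length_cons]
    push_cast
    ring

theorem mpLeadingMoment_cons (hlam : 0 < lam) (hs : s ∈ Set.Ioo (-(π / 2)) (π / 2)) (t : ℝ)
    (ts : List ℝ) :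
    mpLeadingMoment lam s (t :: ts) =
      (lam + ts.length / 2) * leadingFactor s t (ts.count s) * mpLeadingMoment lam s ts := by
  rw [mpLeadingMoment_cons_add_half hlam hs, mul_right_comm,
    cos_mul_mpLeadingMoment_add_half hlam hs, mul_right_comm]

theorem mpLeadingMoment_ne_zero (hlam : 0 < lam) (hs : s ∈ Set.Ioo (-(π / 2)) (π / 2))
    {ts : List ℝ} (hts : ∀ t ∈ ts, t ∈ Set.Ioo (-(π / 2)) (π / 2)) :
    mpLeadingMoment lam s ts ≠ 0 := by
  induction ts with
  | nil => simpa [mpLeadingMoment, mpRodrigues] using mpFunctional_one_ne_zero hlam hs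
  | cons t ts ih =>
    have hlen : ((lam + ts.length / 2 : ℝ) : ℂ) ≠ 0 := Complex.ofReal_ne_zero.2 (by positivity)
    push_cast at hlen
    have hfactor := leadingFactor_ne_zero hs (hts t List.mem_cons_self) (ts.count s)
    rw [mpLeadingMoment_cons hlam hs]
    exact mul_ne_zero (mul_ne_zero hlen (Complex.ofReal_ne_zero.2 hfactor))
      (ih fun u hu => hts u (List.mem_cons_of_mem t hu))

theorem eq_zero_of_degree_lt_of_mem_orthogonalBelow (hlam : 0 < lam) {ts : List ℝ}
    (hts : ∀ t ∈ ts, t ∈ Set.Ioo (-(π / 2)) (π / 2)) {Q : ℂ[X]} (hdeg : Q.degree < ts.length)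
    (hQ : ∀ s ∈ ts, Q ∈ orthogonalBelow (mpFunctional lam s) (ts.count s)) : Q = 0 := by
  induction ts generalizing Q with
  | nil => exact degree_eq_bot.1 (Nat.WithBot.lt_zero_iff.1 hdeg)
  | cons t ts ih =>
    have hts' : ∀ u ∈ ts, u ∈ Set.Ioo (-(π / 2)) (π / 2) :=
      fun u hu => hts u (List.mem_cons_of_mem t hu)
    have hQ_eq : Q = Q.coeff ts.length • mpRodrigues lam ts := by
      refine sub_eq_zero.1
        (ih hts' ((degree_lt_iff_coeff_zero _ _).2 fun m hm => ?_) fun s hs => ?_)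
      · rw [coeff_sub, coeff_smul, smul_eq_mul]
        rcases hm.eq_or_lt with rfl | hm
        · rw [coeff_length_mpRodrigues, mul_one, sub_self]
        · rw [coeff_mpRodrigues_eq_zero lam hm, mul_zero, sub_zero]
          exact (degree_lt_iff_coeff_zero _ _).1 hdeg m hm
      · exact sub_mem (orthogonalBelow_antitone _ List.count_le_count_cons
            (hQ s (List.mem_cons_of_mem t hs)))
          (Submodule.smul_mem _ _ (mpRodrigues_mem_orthogonalBelow hlam (hts' s hs) ts))
    have hmoment := hQ t List.mem_cons_self (ts.count t) (by simp)
    rw [hQ_eq, smul_mul_assoc, map_smul, smul_eq_mul] at hmoment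
    rw [hQ_eq, (mul_eq_zero.1 hmoment).resolve_right
      (mpLeadingMoment_ne_zero hlam (hts t List.mem_cons_self) hts'), zero_smul]

end Rodrigues

section Recurrence

open scoped Real

theorem sum_map_eq_count_smul_add_count_smul {α M : Type*} [DecidableEq α] [AddCommMonoid M]
    {a b : α} (hab : a ≠ b) {l : List α} (hl : ∀ x ∈ l, x = a ∨ x = b) (f : α → M) :
    (l.map f).sum = l.count a • f a + l.count b • f b := by
  induction l with
  | nil => simp
  | cons x l ih =>
    rw [List.map_cons, List.sum_cons, ih fun y hy => hl y (List.mem_cons_of_mem x hy)]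
    rcases hl x List.mem_cons_self with rfl | rfl
    · rw [List.count_cons_self, List.count_cons_of_ne hab, succ_nsmul', add_assoc]
    · rw [List.count_cons_self, List.count_cons_of_ne hab.symm, succ_nsmul', add_left_comm]

theorem length_eq_count_add_count {α : Type*} [DecidableEq α] {a b : α} (hab : a ≠ b)
    {l : List α} (hl : ∀ x ∈ l, x = a ∨ x = b) : l.length = l.count a + l.count b := by
  simpa only [List.map_const', List.sum_replicate, smul_eq_mul, mul_one] using
    sum_map_eq_count_smul_add_count_smul hab hl fun _ => (1 : ℕ)

variable {lam s t₁ t₂ : ℝ}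

theorem mpRodrigues_cons_eq (hlam : 0 < lam) (t : ℝ) {ts : List ℝ}
    (hts : ∀ t ∈ ts, t ∈ Set.Ioo (-(π / 2)) (π / 2)) {R : ℂ[X]} (hdeg : R.degree < ts.length)
    (hR : ∀ s ∈ ts,
      X * mpRodrigues lam ts - R ∈ orthogonalBelow (mpFunctional lam s) (ts.count s)) :
    mpRodrigues lam (t :: ts) =
      (X - C (((lam + ts.length / 2) * Real.tan t + (ts.map Real.tan).sum / 2 : ℝ) : ℂ)) *
        mpRodrigues lam ts - R := by
  set a : ℝ := (lam + ts.length / 2) * Real.tan t + (ts.map Real.tan).sum / 2 with ha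
  refine sub_eq_zero.1 (eq_zero_of_degree_lt_of_mem_orthogonalBelow hlam hts
    ((degree_lt_iff_coeff_zero _ _).2 fun m hm => ?_) fun s hs => ?_)
  · rw [sub_mul, sub_right_comm, coeff_sub, coeff_sub, coeff_sub, coeff_C_mul,
      (degree_lt_iff_coeff_zero _ _).1 hdeg m hm, sub_zero]
    rcases hm.eq_or_lt with rfl | hm
    · have hcons := coeff_length_X_mul_mpRodrigues lam (t :: ts)
      rw [List.length_cons, coeff_X_mul, List.map_cons, List.sum_cons] at hcons
      rw [coeff_length_X_mul_mpRodrigues, coeff_length_mpRodrigues, hcons, ha]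
      push_cast
      ring
    · obtain ⟨m, rfl⟩ := Nat.exists_eq_add_one_of_ne_zero (Nat.ne_zero_of_lt hm)
      rw [coeff_X_mul, coeff_mpRodrigues_eq_zero lam hm, mul_zero, sub_zero, sub_eq_zero]
      rcases (Nat.lt_succ_iff.1 hm).eq_or_lt with rfl | hm
      · rw [coeff_length_mpRodrigues, ← List.length_cons (a := t), coeff_length_mpRodrigues]
      · rw [coeff_mpRodrigues_eq_zero lam hm,
          coeff_mpRodrigues_eq_zero lam (Nat.succ_lt_succ hm)]
  · have horth := mpRodrigues_mem_orthogonalBelow hlam (hts s hs)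
    rw [sub_mul, sub_right_comm, ← smul_eq_C_mul]
    exact sub_mem (orthogonalBelow_antitone _ List.count_le_count_cons (horth (t :: ts)))
      (sub_mem (hR s hs) (Submodule.smul_mem _ _ (horth ts)))

theorem mpRodrigues_cons_replicate (hlam : 0 < lam) (hs : s ∈ Set.Ioo (-(π / 2)) (π / 2)) (t : ℝ)
    (n : ℕ) :
    mpRodrigues lam (t :: List.replicate n s) =
      (X - C (((lam + n / 2) * Real.tan t + n * Real.tan s / 2 : ℝ) : ℂ)) *
          mpRodrigues lam (List.replicate n s) -
        C ((n * (2 * lam + n - 1) / (4 * Real.cos s ^ 2) : ℝ) : ℂ) *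
          mpRodrigues lam (List.replicate (n - 1) s) := by
  have hmem : ∀ u ∈ List.replicate n s, u ∈ Set.Ioo (-(π / 2)) (π / 2) :=
    fun u hu => List.eq_of_mem_replicate hu ▸ hs
  rw [mpRodrigues_cons_eq hlam t hmem
    (R := C ((n * (2 * lam + n - 1) / (4 * Real.cos s ^ 2) : ℝ) : ℂ) *
      mpRodrigues lam (List.replicate (n - 1) s)), List.length_replicate, List.map_replicate,
    List.sum_replicate, nsmul_eq_mul]
  · cases n with
    | zero => simp
    | succ n =>
      rw [← smul_eq_C_mul]
      exact (degree_smul_le _ _).trans_lt (degree_mpRodrigues_lt lam (by simp))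
  · intro u hu
    obtain rfl := List.eq_of_mem_replicate hu
    cases n with
    | zero => simp at hu
    | succ n =>
      have horth (m : ℕ) := mpRodrigues_mem_orthogonalBelow hlam hs (List.replicate m u)
      have hmoment := mpLeadingMoment_cons hlam hs u (List.replicate n u)
      simp only [List.count_replicate_self, mpLeadingMoment, leadingFactor_self,
        List.length_replicate, ← List.replicate_succ] at horth hmoment ⊢
      rw [Nat.add_sub_cancel, ← smul_eq_C_mul]
      refine X_mul_sub_mem_orthogonalBelow (horth _) (Submodule.smul_mem _ _ (horth n)) ?_
      rw [hmoment, smul_mul_assoc, map_smul, smul_eq_mul]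
      push_cast
      ring

theorem mpLeadingMoment_cons_cons_fst (hlam : 0 < lam) (ht₁ : t₁ ∈ Set.Ioo (-(π / 2)) (π / 2))
    (hne : t₁ ≠ t₂) {us : List ℝ} (hus : ∀ u ∈ us, u = t₁ ∨ u = t₂) :
    mpLeadingMoment lam t₁ (t₂ :: t₁ :: us) =
      mpC lam t₁ t₂ (us.count t₁ + 1) (us.count t₂ + 1) * mpLeadingMoment lam t₁ us := by
  rw [mpLeadingMoment_cons hlam ht₁, mpLeadingMoment_cons hlam ht₁, leadingFactor_self,
    leadingFactor_of_ne hne.symm, List.length_cons, length_eq_count_add_count hne hus, mpC]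
  push_cast
  ring

theorem mpLeadingMoment_cons_cons_snd (hlam : 0 < lam) (ht₂ : t₂ ∈ Set.Ioo (-(π / 2)) (π / 2))
    (hne : t₁ ≠ t₂) {us : List ℝ} (hus : ∀ u ∈ us, u = t₁ ∨ u = t₂) :
    mpLeadingMoment lam t₂ (t₂ :: t₁ :: us) =
      mpB lam t₁ t₂ (us.count t₁ + 1) (us.count t₂ + 1) * mpLeadingMoment lam t₂ (t₁ :: us) +
        mpC lam t₁ t₂ (us.count t₁ + 1) (us.count t₂ + 1) * mpLeadingMoment lam t₂ us := by
  rw [mpLeadingMoment_cons hlam ht₂, mpLeadingMoment_cons hlam ht₂, leadingFactor_self,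
    leadingFactor_of_ne hne, List.count_cons_of_ne hne, List.length_cons,
    length_eq_count_add_count hne hus, mpB, mpC]
  push_cast
  ring

theorem X_mul_mpRodrigues_cons_cons_sub_mem (hlam : 0 < lam)
    (hs : s ∈ Set.Ioo (-(π / 2)) (π / 2)) (hne : t₁ ≠ t₂) (hmem : s = t₁ ∨ s = t₂) {us : List ℝ}
    (hus : ∀ u ∈ us, u = t₁ ∨ u = t₂) :
    X * mpRodrigues lam (t₂ :: t₁ :: us) -
        ((mpB lam t₁ t₂ (us.count t₁ + 1) (us.count t₂ + 1) : ℂ) • mpRodrigues lam (t₁ :: us) +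
          (mpC lam t₁ t₂ (us.count t₁ + 1) (us.count t₂ + 1) : ℂ) • mpRodrigues lam us) ∈
      orthogonalBelow (mpFunctional lam s) ((t₂ :: t₁ :: us).count s) := by
  have horth := mpRodrigues_mem_orthogonalBelow hlam hs
  have hts := horth (t₂ :: t₁ :: us)
  have ht₁us := horth (t₁ :: us)
  rcases hmem with rfl | rfl
  · have hmoment := mpLeadingMoment_cons_cons_fst hlam hs hne hus
    simp only [mpLeadingMoment, List.count_cons_self, List.count_cons_of_ne hne.symm]
      at hmoment hts ht₁us ⊢
    refine X_mul_sub_mem_orthogonalBelow hts (add_mem (Submodule.smul_mem _ _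
      (orthogonalBelow_antitone _ (Nat.le_succ _) ht₁us)) (Submodule.smul_mem _ _ (horth us))) ?_
    rw [hmoment, add_mul, map_add, smul_mul_assoc, smul_mul_assoc, map_smul, map_smul,
      ht₁us _ (Nat.lt_succ_self _), smul_zero, zero_add, smul_eq_mul]
  · have hmoment := mpLeadingMoment_cons_cons_snd hlam hs hne hus
    simp only [mpLeadingMoment, List.count_cons_self, List.count_cons_of_ne hne]
      at hmoment hts ht₁us ⊢
    refine X_mul_sub_mem_orthogonalBelow hts (add_mem (Submodule.smul_mem _ _ ht₁us)
      (Submodule.smul_mem _ _ (horth us))) ?_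
    rw [hmoment, add_mul, map_add, smul_mul_assoc, smul_mul_assoc, map_smul, map_smul,
      smul_eq_mul, smul_eq_mul]

theorem mpRodrigues_cons_cons_cons (hlam : 0 < lam) (ht₁ : t₁ ∈ Set.Ioo (-(π / 2)) (π / 2))
    (ht₂ : t₂ ∈ Set.Ioo (-(π / 2)) (π / 2)) (hne : t₁ ≠ t₂) {us : List ℝ}
    (hus : ∀ u ∈ us, u = t₁ ∨ u = t₂) :
    mpRodrigues lam (t₁ :: t₂ :: t₁ :: us) =
      (X - C (mpA lam t₁ t₂ (us.count t₁ + 1) (us.count t₂ + 1) : ℂ)) *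
          mpRodrigues lam (t₂ :: t₁ :: us) -
        C (mpB lam t₁ t₂ (us.count t₁ + 1) (us.count t₂ + 1) : ℂ) * mpRodrigues lam (t₁ :: us) -
        C (mpC lam t₁ t₂ (us.count t₁ + 1) (us.count t₂ + 1) : ℂ) * mpRodrigues lam us := by
  have hmem : ∀ u ∈ t₂ :: t₁ :: us, u = t₁ ∨ u = t₂ := by simpa using hus
  have hIoo : ∀ u ∈ t₂ :: t₁ :: us, u ∈ Set.Ioo (-(π / 2)) (π / 2) := fun u hu => by
    rcases hmem u hu with rfl | rfl <;> assumption
  have ha : mpA lam t₁ t₂ (us.count t₁ + 1) (us.count t₂ + 1) =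
      (lam + (t₂ :: t₁ :: us).length / 2) * Real.tan t₁ +
        ((t₂ :: t₁ :: us).map Real.tan).sum / 2 := by
    rw [List.map_cons, List.map_cons, List.sum_cons, List.sum_cons, List.length_cons,
      List.length_cons, length_eq_count_add_count hne hus,
      sum_map_eq_count_smul_add_count_smul hne hus, nsmul_eq_mul, nsmul_eq_mul, mpA]
    push_cast
    ring
  rw [ha, ← smul_eq_C_mul (mpB .. : ℂ), ← smul_eq_C_mul (mpC .. : ℂ), sub_sub]
  refine mpRodrigues_cons_eq hlam t₁ hIoo ?_ fun s hs =>
    X_mul_mpRodrigues_cons_cons_sub_mem hlam (hIoo s hs) hne (hmem s hs) hus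
  refine mem_degreeLT.1 (add_mem (Submodule.smul_mem _ _ ?_) (Submodule.smul_mem _ _ ?_)) <;>
    exact mem_degreeLT.2 (degree_mpRodrigues_lt lam (by simp))

end Recurrence

section Descent

open scoped Real

variable {lam t₁ t₂ : ℝ}

theorem map_ofReal_mem_orthogonalBelow_iff {t : ℝ} (hlam : 0 < lam)
    (ht : t ∈ Set.Ioo (-(π / 2)) (π / 2)) {n : ℕ} {P : ℝ[X]} :
    P.map Complex.ofRealHom ∈ orthogonalBelow (mpFunctional lam t) n ↔
      ∀ m < n, ∫ x : ℝ, P.eval x * x ^ m * mpWeight lam t x = 0 :=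
  forall₂_congr fun m _ => by
    rw [mpFunctional, momentFunctional_map_mul_X_pow (integrable_pow_mul_mpWeight hlam ht),
      Complex.ofReal_eq_zero]

theorem map_ofReal_injective : Function.Injective (Polynomial.map Complex.ofRealHom) :=
  map_injective _ Complex.ofRealHom.injective

theorem exists_map_ofReal_eq_mpRodrigues (lam : ℝ) (ts : List ℝ) :
    ∃ P : ℝ[X], P.map Complex.ofRealHom = mpRodrigues lam ts := by
  refine (mem_lifts _).1 ((lifts_iff_coeff_lifts _).2 fun n => ?_)
  have hconj := congrArg (coeff · n) (map_conj_mpRodrigues lam ts)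
  simp only [coeff_map] at hconj
  obtain ⟨r, hr⟩ := Complex.conj_eq_iff_real.1 hconj
  exact ⟨r, hr.symm⟩

theorem isMultipleMP_iff_map_eq_mpRodrigues (hlam : 0 < lam) (ht₁ : t₁ ∈ Set.Ioo (-(π / 2)) (π / 2))
    (ht₂ : t₂ ∈ Set.Ioo (-(π / 2)) (π / 2)) (hne : t₁ ≠ t₂) {ts : List ℝ}
    (hts : ∀ t ∈ ts, t = t₁ ∨ t = t₂) {P : ℝ[X]} :
    IsMultipleMP lam t₁ t₂ (ts.count t₁) (ts.count t₂) P ↔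
      P.map Complex.ofRealHom = mpRodrigues lam ts := by
  have hlen := length_eq_count_add_count hne hts
  have horth {s : ℝ} (hs : s ∈ Set.Ioo (-(π / 2)) (π / 2)) :=
    mpRodrigues_mem_orthogonalBelow hlam hs ts
  constructor
  · intro h
    have hIoo : ∀ t ∈ ts, t ∈ Set.Ioo (-(π / 2)) (π / 2) := fun t ht => by
      rcases hts t ht with rfl | rfl <;> assumption
    refine sub_eq_zero.1 (eq_zero_of_degree_lt_of_mem_orthogonalBelow hlam hIoo
      ((degree_lt_iff_coeff_zero _ _).2 fun m hm => ?_) fun s hs => sub_mem ?_ (horth (hIoo s hs)))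
    · rw [coeff_sub, coeff_map]
      rcases hm.eq_or_lt with rfl | hm
      · rw [coeff_length_mpRodrigues, hlen, ← h.natDegree_eq, h.monic.coeff_natDegree, map_one,
          sub_self]
      · rw [coeff_mpRodrigues_eq_zero lam hm, coeff_eq_zero_of_natDegree_lt
          ((h.natDegree_eq.trans hlen.symm).trans_lt hm), map_zero, sub_zero]
    · rcases hts s hs with rfl | rfl
      · exact (map_ofReal_mem_orthogonalBelow_iff hlam ht₁).2 h.orthogonal_fst
      · exact (map_ofReal_mem_orthogonalBelow_iff hlam ht₂).2 h.orthogonal_snd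
  · intro h
    have hle : P.natDegree ≤ ts.length := by
      rw [← natDegree_map_eq_of_injective Complex.ofRealHom.injective P, h]
      exact natDegree_mpRodrigues_le lam ts
    have hcoeff : P.coeff ts.length = 1 := Complex.ofRealHom.injective (by
      rw [← coeff_map, h, coeff_length_mpRodrigues, map_one])
    exact ⟨monic_of_natDegree_le_of_coeff_eq_one _ hle hcoeff,
      hlen ▸ natDegree_eq_of_le_of_coeff_ne_zero hle (by rw [hcoeff]; exact one_ne_zero),
      (map_ofReal_mem_orthogonalBelow_iff hlam ht₁).1 (h ▸ horth ht₁),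
      (map_ofReal_mem_orthogonalBelow_iff hlam ht₂).1 (h ▸ horth ht₂)⟩

theorem existsUnique_isMultipleMP (hlam : 0 < lam) (ht₁ : t₁ ∈ Set.Ioo (-(π / 2)) (π / 2))
    (ht₂ : t₂ ∈ Set.Ioo (-(π / 2)) (π / 2)) (hne : t₁ ≠ t₂) (k₁ k₂ : ℕ) :
    ∃! P : ℝ[X], IsMultipleMP lam t₁ t₂ k₁ k₂ P := by
  set ts := List.replicate k₁ t₁ ++ List.replicate k₂ t₂ with hts
  have hmem : ∀ t ∈ ts, t = t₁ ∨ t = t₂ := by simp +contextual [hts, or_imp]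
  have hcount₁ : ts.count t₁ = k₁ := by simp [hts, List.count_replicate, hne.symm]
  have hcount₂ : ts.count t₂ = k₂ := by simp [hts, List.count_replicate, hne]
  have hiff (P : ℝ[X]) := isMultipleMP_iff_map_eq_mpRodrigues hlam ht₁ ht₂ hne hmem (P := P)
  rw [hcount₁, hcount₂] at hiff
  obtain ⟨P, hP⟩ := exists_map_ofReal_eq_mpRodrigues lam ts
  exact ⟨P, (hiff P).2 hP, fun Q hQ => map_ofReal_injective (((hiff Q).1 hQ).trans hP.symm)⟩

theorem map_multipleMP (hlam : 0 < lam) (ht₁ : t₁ ∈ Set.Ioo (-(π / 2)) (π / 2))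
    (ht₂ : t₂ ∈ Set.Ioo (-(π / 2)) (π / 2)) (hne : t₁ ≠ t₂) {ts : List ℝ}
    (hts : ∀ t ∈ ts, t = t₁ ∨ t = t₂) {k₁ k₂ : ℤ} (hk₁ : ts.count t₁ = k₁)
    (hk₂ : ts.count t₂ = k₂) :
    (multipleMP lam t₁ t₂ k₁ k₂).map Complex.ofRealHom = mpRodrigues lam ts := by
  subst hk₁ hk₂
  exact (isMultipleMP_iff_map_eq_mpRodrigues hlam ht₁ ht₂ hne hts).1
    (multipleMP_spec (existsUnique_isMultipleMP hlam ht₁ ht₂ hne _ _).exists)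

theorem IsMultipleMP.symm {k₁ k₂ : ℕ} {P : ℝ[X]} (h : IsMultipleMP lam t₁ t₂ k₁ k₂ P) :
    IsMultipleMP lam t₂ t₁ k₂ k₁ P :=
  ⟨h.monic, h.natDegree_eq.trans (add_comm _ _), h.orthogonal_snd, h.orthogonal_fst⟩

theorem multipleMP_comm (lam t₁ t₂ : ℝ) (k₁ k₂ : ℤ) :
    multipleMP lam t₁ t₂ k₁ k₂ = multipleMP lam t₂ t₁ k₂ k₁ := by
  have hpred : IsMultipleMP lam t₁ t₂ k₁.toNat k₂.toNat =
      IsMultipleMP lam t₂ t₁ k₂.toNat k₁.toNat :=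
    funext fun P => propext ⟨IsMultipleMP.symm, IsMultipleMP.symm⟩
  have hcond : (0 ≤ k₁ ∧ 0 ≤ k₂ ∧ ∃ P, IsMultipleMP lam t₁ t₂ k₁.toNat k₂.toNat P) =
      (0 ≤ k₂ ∧ 0 ≤ k₁ ∧ ∃ P, IsMultipleMP lam t₂ t₁ k₂.toNat k₁.toNat P) := by
    rw [hpred]
    exact propext and_left_comm
  classical
  exact dite_congr hcond (fun _ => by congr 1) fun _ => rfl

theorem multipleMP_one_left (hlam : 0 < lam) (ht₁ : t₁ ∈ Set.Ioo (-(π / 2)) (π / 2))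
    (ht₂ : t₂ ∈ Set.Ioo (-(π / 2)) (π / 2)) (hne : t₁ ≠ t₂) (k₂ : ℕ) :
    multipleMP lam t₁ t₂ 1 k₂ =
      (X - C (mpA lam t₁ t₂ 0 k₂)) * multipleMP lam t₁ t₂ 0 k₂
        - C (mpB lam t₁ t₂ 0 k₂) * multipleMP lam t₁ t₂ 0 (k₂ - 1) := by
  have hmap (n : ℕ) : (multipleMP lam t₁ t₂ 0 n).map Complex.ofRealHom =
      mpRodrigues lam (List.replicate n t₂) :=
    map_multipleMP hlam ht₁ ht₂ hne (by simp) (by simp [List.count_replicate, hne.symm]) (by simp)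
  have hprev : C (mpB lam t₁ t₂ 0 k₂ : ℂ) *
      (multipleMP lam t₁ t₂ 0 (k₂ - 1)).map Complex.ofRealHom =
      C (mpB lam t₁ t₂ 0 k₂ : ℂ) * mpRodrigues lam (List.replicate (k₂ - 1) t₂) := by
    cases k₂ with
    | zero => simp [mpB]
    | succ n => rw [← hmap, Nat.add_sub_cancel, Nat.cast_succ, add_sub_cancel_right]
  refine map_ofReal_injective ?_
  simp only [Polynomial.map_sub, Polynomial.map_mul, map_C, map_X, Complex.ofRealHom_eq_coe]
  rw [hprev, hmap, map_multipleMP hlam ht₁ ht₂ hne (ts := t₁ :: List.replicate k₂ t₂) (by simp)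
    (by simp [List.count_replicate, hne.symm]) (by simp [hne]),
    mpRodrigues_cons_replicate hlam ht₂]
  congr 5
  · rw [mpA]
    push_cast
    ring
  · rw [mpB]
    push_cast
    ring

theorem multipleMP_succ_zero (hlam : 0 < lam) (ht₁ : t₁ ∈ Set.Ioo (-(π / 2)) (π / 2))
    (ht₂ : t₂ ∈ Set.Ioo (-(π / 2)) (π / 2)) (hne : t₁ ≠ t₂) (k₁ : ℕ) :
    multipleMP lam t₁ t₂ (k₁ + 1) 0 =
      (X - C (mpA lam t₁ t₂ k₁ 0)) * multipleMP lam t₁ t₂ k₁ 0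
        - C (mpB lam t₁ t₂ k₁ 0) * multipleMP lam t₁ t₂ (k₁ - 1) 0 := by
  have hmap (n : ℕ) : (multipleMP lam t₁ t₂ n 0).map Complex.ofRealHom =
      mpRodrigues lam (List.replicate n t₁) :=
    map_multipleMP hlam ht₁ ht₂ hne (by simp) (by simp) (by simp [List.count_replicate, hne])
  have hprev : C (mpB lam t₁ t₂ k₁ 0 : ℂ) *
      (multipleMP lam t₁ t₂ (k₁ - 1) 0).map Complex.ofRealHom =
      C (mpB lam t₁ t₂ k₁ 0 : ℂ) * mpRodrigues lam (List.replicate (k₁ - 1) t₁) := by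
    cases k₁ with
    | zero => simp [mpB]
    | succ n => rw [← hmap, Nat.add_sub_cancel, Nat.cast_succ, add_sub_cancel_right]
  refine map_ofReal_injective ?_
  simp only [Polynomial.map_sub, Polynomial.map_mul, map_C, map_X, Complex.ofRealHom_eq_coe]
  rw [hprev, hmap, ← Nat.cast_succ, hmap, List.replicate_succ, mpRodrigues_cons_replicate hlam ht₁]
  congr 5
  · rw [mpA]
    push_cast
    ring
  · rw [mpB]
    push_cast
    ring

theorem multipleMP_succ_succ (hlam : 0 < lam) (ht₁ : t₁ ∈ Set.Ioo (-(π / 2)) (π / 2))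
    (ht₂ : t₂ ∈ Set.Ioo (-(π / 2)) (π / 2)) (hne : t₁ ≠ t₂) (m n : ℕ) :
    multipleMP lam t₁ t₂ (m + 2) (n + 1) =
      (X - C (mpA lam t₁ t₂ (m + 1) (n + 1))) * multipleMP lam t₁ t₂ (m + 1) (n + 1)
        - C (mpB lam t₁ t₂ (m + 1) (n + 1)) * multipleMP lam t₁ t₂ (m + 1) n
        - C (mpC lam t₁ t₂ (m + 1) (n + 1)) * multipleMP lam t₁ t₂ m n := by
  set us := List.replicate m t₁ ++ List.replicate n t₂ with hus
  have hmem : ∀ t ∈ us, t = t₁ ∨ t = t₂ := by simp +contextual [hus, or_imp]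
  have hcount₁ : us.count t₁ = m := by simp [hus, List.count_replicate, hne.symm]
  have hcount₂ : us.count t₂ = n := by simp [hus, List.count_replicate, hne]
  have hmap {ts : List ℝ} (hts : ∀ t ∈ ts, t = t₁ ∨ t = t₂) {k₁ k₂ : ℤ} :=
    map_multipleMP hlam ht₁ ht₂ hne hts (k₁ := k₁) (k₂ := k₂)
  have hrec := mpRodrigues_cons_cons_cons hlam ht₁ ht₂ hne hmem
  rw [hcount₁, hcount₂] at hrec
  refine map_ofReal_injective ?_
  simp only [Polynomial.map_sub, Polynomial.map_mul, map_C, map_X, Complex.ofRealHom_eq_coe]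
  rw [hmap (ts := t₁ :: t₂ :: t₁ :: us) (by simpa using hmem)
      (by simp [hcount₁, hne.symm, add_assoc]) (by simp [hcount₂, hne]),
    hmap (ts := t₂ :: t₁ :: us) (by simpa using hmem) (by simp [hcount₁, hne.symm])
      (by simp [hcount₂, hne]),
    hmap (ts := t₁ :: us) (by simpa using hmem) (by simp [hcount₁]) (by simp [hcount₂, hne]),
    hmap hmem (by simp [hcount₁]) (by simp [hcount₂]), hrec]

theorem multipleMP_succ_left (hlam : 0 < lam) (ht₁ : t₁ ∈ Set.Ioo (-(π / 2)) (π / 2))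
    (ht₂ : t₂ ∈ Set.Ioo (-(π / 2)) (π / 2)) (hne : t₁ ≠ t₂) (k₁ k₂ : ℕ) (hk : 1 ≤ k₂ ∨ k₁ = 0) :
    multipleMP lam t₁ t₂ (k₁ + 1) k₂ =
      (X - C (mpA lam t₁ t₂ k₁ k₂)) * multipleMP lam t₁ t₂ k₁ k₂
        - C (mpB lam t₁ t₂ k₁ k₂) * multipleMP lam t₁ t₂ k₁ (k₂ - 1)
        - C (mpC lam t₁ t₂ k₁ k₂) * multipleMP lam t₁ t₂ (k₁ - 1) (k₂ - 1) := by
  rcases k₁ with _ | m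
  · simpa [mpC] using multipleMP_one_left hlam ht₁ ht₂ hne k₂
  · obtain ⟨n, rfl⟩ := Nat.exists_eq_add_one_of_ne_zero (show k₂ ≠ 0 by omega)
    simpa [add_assoc, one_add_one_eq_two] using multipleMP_succ_succ hlam ht₁ ht₂ hne m n

end Descent

theorem theorem2p2 (lam t₁ t₂ : ℝ) (hlam : 0 < lam)
    (ht₁ : t₁ ∈ Set.Ioo (-(Real.pi / 2)) (Real.pi / 2))
    (ht₂ : t₂ ∈ Set.Ioo (-(Real.pi / 2)) (Real.pi / 2))
    (hne : t₁ ≠ t₂) :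
    -- the multiple Meixner-Pollaczek polynomials are well defined
    (∀ k₁ k₂ : ℕ, ∃! P : ℝ[X], IsMultipleMP lam t₁ t₂ k₁ k₂ P) ∧
    -- the two four term recurrences
    (∀ k₁ k₂ : ℕ, (1 ≤ k₂ ∨ k₁ = 0) →
      multipleMP lam t₁ t₂ (k₁ + 1) k₂ =
        (X - C (mpA lam t₁ t₂ k₁ k₂)) * multipleMP lam t₁ t₂ k₁ k₂
          - C (mpB lam t₁ t₂ k₁ k₂) * multipleMP lam t₁ t₂ k₁ (k₂ - 1)
          - C (mpC lam t₁ t₂ k₁ k₂) * multipleMP lam t₁ t₂ (k₁ - 1) (k₂ - 1)) ∧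
    (∀ k₁ k₂ : ℕ, (1 ≤ k₁ ∨ k₂ = 0) →
      multipleMP lam t₁ t₂ k₁ (k₂ + 1) =
        (X - C (mpA lam t₂ t₁ k₂ k₁)) * multipleMP lam t₁ t₂ k₁ k₂
          - C (mpB lam t₂ t₁ k₂ k₁) * multipleMP lam t₁ t₂ (k₁ - 1) k₂
          - C (mpC lam t₂ t₁ k₂ k₁) * multipleMP lam t₁ t₂ (k₁ - 1) (k₂ - 1)) ∧
    -- the remaining boundary cases, where only one weight is involved
    (∀ k₁ : ℕ, multipleMP lam t₁ t₂ (k₁ + 1) 0 =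
        (X - C (mpA lam t₁ t₂ k₁ 0)) * multipleMP lam t₁ t₂ k₁ 0
          - C (mpB lam t₁ t₂ k₁ 0) * multipleMP lam t₁ t₂ (k₁ - 1) 0) ∧
    (∀ k₂ : ℕ, multipleMP lam t₁ t₂ 0 (k₂ + 1) =
        (X - C (mpA lam t₂ t₁ k₂ 0)) * multipleMP lam t₁ t₂ 0 k₂
          - C (mpB lam t₂ t₁ k₂ 0) * multipleMP lam t₁ t₂ 0 (k₂ - 1)) := by
  refine ⟨existsUnique_isMultipleMP hlam ht₁ ht₂ hne, multipleMP_succ_left hlam ht₁ ht₂ hne,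
    fun k₁ k₂ hk => ?_, multipleMP_succ_zero hlam ht₁ ht₂ hne, fun k₂ => ?_⟩
  · simp only [multipleMP_comm lam t₁ t₂]
    exact multipleMP_succ_left hlam ht₂ ht₁ hne.symm k₂ k₁ hk
  · simp only [multipleMP_comm lam t₁ t₂]
    exact multipleMP_succ_zero hlam ht₂ ht₁ hne.symm k₂
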